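/- Let $\mathbb{B}_d=\{x\in\mathbb{R}^d:\|x\|_2\le 1\}$ and let $\theta\in\mathbb{R}^d$ be an unknown reward vector. At each round $t$, a learner selects an action $x_t\in\mathbb{B}_d$, depending (measurably) only on its private randomness and on the rewards observed in earlier rounds, and observes $y_t=\langle x_t,\theta\rangle+\eta_t$, where the $\eta_t\sim\mathcal{N}(0,1)$ are i.i.d. and independent of the private randomness. The learner also decides, from the same information, when to stop and which estimate to return. There is an absolute constant $C>0$ such that for every dimension $d\ge 1$, every $\varepsilon\in(0,1]$ and every $\delta\in(0,1)$ there exists such an adaptive algorithm (which may depend on $d,\varepsilon,\delta$, but not on $\theta$) with the following property. For every $\theta\in\mathbb{R}^d$, the algorithm always stops after at most $$C\,\frac{d\,\max\{1,\log(1/\delta)\}}{\varepsilon^2}$$ observations, and the estimate $\widehat r$ that it returns satisfies $|\widehat r-\|\theta\|_2|\le\varepsilon$ with probability at least $1-\delta$. In particular, for $\delta\in(0,1/3)$ the number of observations is at most $C\,d\log(1/\delta)/\varepsilon^2$. -/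

import Mathlib

open MeasureTheory ProbabilityTheory

/-- A (randomized, adaptive) norm-estimation algorithm that queries points of the closed unit
Euclidean ball of `ℝ^d`.  Before round `t` (rounds are numbered from `0`) the learner knows its
private random seed and the `t` rewards observed so far; its past queries are functions of these.
From this information alone it decides whether to end, which point to query if it goes on, and
what to return at the end. -/
structure BallAlgorithm (d : ℕ) where
  /-- The space of private random seeds. -/
  Seed : Type
  [seedSpace : MeasurableSpace Seed]
  /-- The law of the private random seed. -/
  seedLaw : Measure Seed
  [seedProb : IsProbabilityMeasure seedLaw]
  /-- The sampling rule: the point queried in round `t`. -/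
  query (t : ℕ) : Seed → (Fin t → ℝ) → EuclideanSpace ℝ (Fin d)
  /-- The stopping rule: whether to end the sampling after exactly `t` observations. -/
  halt (t : ℕ) : Seed → (Fin t → ℝ) → Prop
  /-- The estimate that is returned after stopping with `t` observations. -/
  output (t : ℕ) : Seed → (Fin t → ℝ) → ℝ
  norm_query_le : ∀ t u y, ‖query t u y‖ ≤ 1
  measurable_query : ∀ t, Measurable fun p : Seed × (Fin t → ℝ) => query t p.1 p.2
  measurableSet_halt : ∀ t, MeasurableSet {p : Seed × (Fin t → ℝ) | halt t p.1 p.2}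
  measurable_output : ∀ t, Measurable fun p : Seed × (Fin t → ℝ) => output t p.1 p.2

namespace BallAlgorithm

attribute [instance] BallAlgorithm.seedSpace BallAlgorithm.seedProb

variable {d : ℕ} (A : BallAlgorithm d)

/-- The first `t` observed rewards, for the reward vector `θ`, the seed `u` and the noise sequence
`η`, if the learner keeps sampling: `y_t = ⟨x_t, θ⟩ + η_t`, where `x_t` is the point queried
on the basis of `u` and `y_0, …, y_{t-1}`. -/
noncomputable def history (θ : EuclideanSpace ℝ (Fin d)) (u : A.Seed) (η : ℕ → ℝ) :
    (t : ℕ) → (Fin t → ℝ)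
  | 0 => Fin.elim0
  | t + 1 => Fin.snoc (α := fun _ => ℝ) (history θ u η t)
      (inner ℝ (A.query t u (history θ u η t)) θ + η t)

/-- The number of observations that the learner takes: the first time at which the stopping rule
applies, and `⊤` if it never does. -/
noncomputable def numSamples (θ : EuclideanSpace ℝ (Fin d)) (u : A.Seed) (η : ℕ → ℝ) : ℕ∞ :=
  ⨅ (t : ℕ) (_ : A.halt t u (A.history θ u η t)), (t : ℕ∞)

/-- The estimate returned by the learner (meaningful if the learner ends the sampling). -/
noncomputable def estimate (θ : EuclideanSpace ℝ (Fin d)) (u : A.Seed) (η : ℕ → ℝ) : ℝ :=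
  A.output (A.numSamples θ u η).toNat u (A.history θ u η (A.numSamples θ u η).toNat)

/-- The joint law of the private seed and the noise: the noise variables are i.i.d. standard
Gaussian and independent of the seed. -/
noncomputable def law : Measure (A.Seed × (ℕ → ℝ)) :=
  A.seedLaw.prod (Measure.infinitePi fun _ : ℕ => gaussianReal 0 1)

end BallAlgorithm

/-! Take `n` of order `max 1 (log (1/δ)) / ε²`. The first stage yields `Z = θ + W`, where `W` has
covariance `I/n`. Using `‖Z‖²` would square the noise and add a bias of `d/n`. Instead, the second
stage spends `n * d` queries on `Z/‖Z‖`, with averaged noise `S` of variance `1/(n * d)`.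
Multiplying its mean by `‖Z‖` gives `T = ‖θ‖² + ⟪W, θ⟫ + ‖Z‖ S`. Here `⟪W, θ⟫` is a one-dimensional
fluctuation of size `ε‖θ‖`. Moreover `‖Z‖ ≤ ‖θ‖ + √d ε` while `S` is of size `ε/√d`, so the
dimension cancels and `|T - ‖θ‖²| ≤ ε(‖θ‖ + ε)/2`. `abs_sqrt_sub_le` turns this into error `ε`.
Three tail bounds and a union bound suffice, with no conditioning on the first stage, since `W` and
`S` are fixed linear functions of the noise. -/

section GaussianCombinations

/-! ### Tails of Gaussian linear combinations -/

/-- The law of the noise sequence. -/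
noncomputable abbrev noiseLaw : Measure (ℕ → ℝ) :=
  Measure.infinitePi fun _ : ℕ => gaussianReal 0 1

lemma map_sum_mul_noiseLaw (s : Finset ℕ) (c : ℕ → ℝ) :
    noiseLaw.map (fun η => ∑ k ∈ s, c k * η k) =
      gaussianReal 0 (∑ k ∈ s, c k ^ 2).toNNReal := by
  classical
  induction s using Finset.induction_on with
  | empty => simp [Measure.map_const]
  | insert a s ha ih =>
    have hind : iIndepFun (fun k (η : ℕ → ℝ) => c k * η k) noiseLaw :=
      iIndepFun_infinitePi (P := fun _ : ℕ => gaussianReal 0 1)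
        (X := fun k x => c k * x) (fun k => by fun_prop)
    have h1 : noiseLaw.map (fun η : ℕ → ℝ => c a * η a) =
        gaussianReal 0 (c a ^ 2).toNNReal := by
      have : (fun η : ℕ → ℝ => c a * η a) = (fun x => c a * x) ∘ (Function.eval a) := rfl
      rw [this, ← Measure.map_map (by fun_prop) (by fun_prop), Measure.infinitePi_map_eval,
        gaussianReal_map_const_mul, mul_zero, mul_one]
      congr 1
      exact NNReal.coe_injective (Real.coe_toNNReal _ (sq_nonneg _)).symm
    have h2 : IndepFun (fun η : ℕ → ℝ => c a * η a) (fun η => ∑ k ∈ s, c k * η k) noiseLaw := by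
      have := (hind.indepFun_finsetSum_of_notMem (fun k => by fun_prop) ha).symm
      convert this using 1
      ext η
      simp
    have h3 := gaussianReal_add_gaussianReal_of_indepFun h2 h1 ih
    rw [zero_add, ← Real.toNNReal_add (sq_nonneg _) (Finset.sum_nonneg fun _ _ => sq_nonneg _),
      ← Finset.sum_insert (f := fun k => c k ^ 2) ha] at h3
    rw [← h3]
    congr 1
    ext η
    simp [Finset.sum_insert ha]

lemma hasSubgaussianMGF_sum_mul (s : Finset ℕ) (c : ℕ → ℝ) {v : NNReal}
    (hv : ∑ k ∈ s, c k ^ 2 ≤ v) :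
    HasSubgaussianMGF (fun η : ℕ → ℝ => ∑ k ∈ s, c k * η k) v noiseLaw := by
  have hlaw := map_sum_mul_noiseLaw s c
  have hm : Measurable (fun η : ℕ → ℝ => ∑ k ∈ s, c k * η k) := by fun_prop
  constructor
  · intro t
    have := integrable_exp_mul_gaussianReal (μ := 0)
      (v := (∑ k ∈ s, c k ^ 2).toNNReal) t
    rw [← hlaw] at this
    exact this.comp_measurable hm
  · intro t
    rw [mgf_gaussianReal hlaw, Real.coe_toNNReal _ (Finset.sum_nonneg fun _ _ => sq_nonneg _)]
    gcongr
    nlinarith [sq_nonneg t]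

lemma noiseLaw_abs_sum_mul_ge (s : Finset ℕ) (c : ℕ → ℝ) {v t : ℝ} (hv0 : 0 ≤ v)
    (hv : ∑ k ∈ s, c k ^ 2 ≤ v) (ht : 0 ≤ t) :
    noiseLaw.real {η | t ≤ |∑ k ∈ s, c k * η k|} ≤ 2 * Real.exp (-t ^ 2 / (2 * v)) := by
  lift v to NNReal using hv0
  have h := hasSubgaussianMGF_sum_mul s c hv
  have h1 := h.measure_ge_le ht
  have h2 := h.neg.measure_ge_le ht
  have hsub : {η : ℕ → ℝ | t ≤ |∑ k ∈ s, c k * η k|} ⊆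
      {η | t ≤ ∑ k ∈ s, c k * η k} ∪
        {η | t ≤ (-fun η : ℕ → ℝ => ∑ k ∈ s, c k * η k) η} := by
    intro η hη
    simpa [le_abs] using hη
  calc _ ≤ _ := measureReal_mono hsub
    _ ≤ _ := measureReal_union_le _ _
    _ ≤ _ := by linarith

lemma lintegral_exp_sq_div_four_gaussianReal :
    ∫⁻ x, ENNReal.ofReal (Real.exp (x ^ 2 / 4)) ∂(gaussianReal 0 1) = ENNReal.ofReal √2 := by
  rw [gaussianReal_of_var_ne_zero _ one_ne_zero,
    lintegral_withDensity_eq_lintegral_mul _ (measurable_gaussianPDF 0 1) (by fun_prop)]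
  have h : ∀ x : ℝ, (gaussianPDF 0 1 * fun x : ℝ => ENNReal.ofReal (Real.exp (x ^ 2 / 4))) x =
      ENNReal.ofReal ((√(2 * Real.pi))⁻¹ * Real.exp (-(1 / 4) * x ^ 2)) := by
    intro x
    rw [Pi.mul_apply, gaussianPDF, ← ENNReal.ofReal_mul (gaussianPDFReal_nonneg _ _ _),
      gaussianPDFReal, mul_assoc, ← Real.exp_add]
    congr 3
    · simp
    · simp; ring
  simp_rw [h]
  rw [← ofReal_integral_eq_lintegral_ofReal, integral_const_mul, integral_gaussian]
  · congr 1
    rw [← Real.sqrt_inv, ← Real.sqrt_mul (by positivity)]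
    congr 1
    field_simp
    norm_num
  · exact (integrable_exp_neg_mul_sq (by norm_num)).const_mul _
  · exact Filter.Eventually.of_forall fun x => by positivity

/-- A tail bound for the sum of the squares of standard Gaussian linear combinations, which need
not be independent. -/
lemma noiseLaw_sum_sq_ge {d : ℕ} (hd : 0 < d) (s : Finset ℕ) (c : Fin d → ℕ → ℝ)
    (hc : ∀ i, ∑ k ∈ s, c i k ^ 2 = 1) (t : ℝ) :
    noiseLaw.real {η | d * t ≤ ∑ i, (∑ k ∈ s, c i k * η k) ^ 2} ≤ 2 * Real.exp (-t / 4) := by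
  have hd' : (0 : ℝ) < d := by exact_mod_cast hd
  set X : Fin d → (ℕ → ℝ) → ℝ := fun i η => ∑ k ∈ s, c i k * η k with hX
  have hXm : ∀ i, Measurable (X i) := fun i => by fun_prop
  have hlaw : ∀ i, noiseLaw.map (X i) = gaussianReal 0 1 := by
    intro i
    rw [hX, map_sum_mul_noiseLaw, hc, Real.toNNReal_one]
  have hexp : ∀ i, ∫⁻ η, ENNReal.ofReal (Real.exp (X i η ^ 2 / 4)) ∂noiseLaw =
      ENNReal.ofReal √2 := by
    intro i
    rw [← lintegral_exp_sq_div_four_gaussianReal, ← hlaw i,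
      lintegral_map (by fun_prop) (hXm i)]
  have hpt : ∀ η ∈ {η | d * t ≤ ∑ i, X i η ^ 2},
      d * Real.exp (t / 4) ≤ ∑ i, Real.exp (X i η ^ 2 / 4) := by
    intro η hη
    -- Jensen bounds the exponential of the average square by the average of the exponentials, so
    -- each coordinate enters through its own law only. In the Markov bound below the factor `d`
    -- cancels.
    have hJ := convexOn_exp.map_sum_le (t := Finset.univ) (w := fun _ : Fin d => (d : ℝ)⁻¹)
      (p := fun i => X i η ^ 2 / 4) (fun _ _ => by positivity)
      (by simp [hd'.ne']) (fun _ _ => Set.mem_univ _)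
    simp only [smul_eq_mul, ← Finset.mul_sum, ← Finset.sum_div] at hJ
    rw [inv_mul_eq_div, inv_mul_eq_div, le_div_iff₀ hd'] at hJ
    have : t / 4 ≤ (∑ i, X i η ^ 2) / 4 / d := by
      rw [le_div_iff₀ hd']
      have : d * t ≤ ∑ i, X i η ^ 2 := hη
      linarith
    have := Real.exp_le_exp.2 this
    nlinarith
  have hM := mul_meas_ge_le_lintegral₀ (μ := noiseLaw)
    (f := fun η => ∑ i, ENNReal.ofReal (Real.exp (X i η ^ 2 / 4)))
    (by fun_prop) (ENNReal.ofReal (d * Real.exp (t / 4)))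
  rw [lintegral_finsetSum _ (fun i _ => by fun_prop)] at hM
  simp only [hexp, Finset.sum_const, Finset.card_univ, Fintype.card_fin, nsmul_eq_mul] at hM
  have hsub : {η | d * t ≤ ∑ i, X i η ^ 2} ⊆ {η | ENNReal.ofReal (d * Real.exp (t / 4)) ≤
      ∑ i, ENNReal.ofReal (Real.exp (X i η ^ 2 / 4))} := by
    intro η hη
    rw [Set.mem_ofPred_eq, ← ENNReal.ofReal_sum_of_nonneg (fun _ _ => by positivity)]
    exact ENNReal.ofReal_le_ofReal (hpt η hη)
  have hM' : ENNReal.ofReal (d * Real.exp (t / 4)) * noiseLaw {η | d * t ≤ ∑ i, X i η ^ 2} ≤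
      d * ENNReal.ofReal √2 := le_trans (by gcongr) hM
  have hR := ENNReal.toReal_mono (by finiteness) hM'
  rw [ENNReal.toReal_mul, ENNReal.toReal_mul, ENNReal.toReal_ofReal (by positivity),
    ENNReal.toReal_ofReal (by positivity), ENNReal.toReal_natCast, mul_assoc] at hR
  have hR' : Real.exp (t / 4) * noiseLaw.real {η | d * t ≤ ∑ i, X i η ^ 2} ≤ √2 :=
    le_of_mul_le_mul_left hR hd'
  have h2 : √2 ≤ 2 := by
    rw [Real.sqrt_le_left (by norm_num)]
    norm_num
  have he : Real.exp (-t / 4) = (Real.exp (t / 4))⁻¹ := by rw [neg_div, Real.exp_neg]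
  rw [he, ← div_eq_mul_inv, le_div_iff₀ (Real.exp_pos _)]
  linarith

end GaussianCombinations

/-! ### Averaged observations and their noise -/

section Averages

lemma sum_range_mul_mod {d : ℕ} (hd : 0 < d) (n : ℕ) (f : Fin d → ℝ) :
    ∑ k ∈ Finset.range (n * d), f ⟨k % d, Nat.mod_lt _ hd⟩ = n * ∑ i, f i := by
  induction n with
  | zero => simp
  | succ n ih =>
    rw [add_mul, one_mul, Finset.sum_range_add, ih, Finset.sum_range, Nat.cast_succ, add_mul,
      one_mul]
    congr 1
    refine Finset.sum_congr rfl fun i _ => ?_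
    congr 1
    ext
    simp [Nat.mod_eq_of_lt i.2]

/-- The weight of the observation `k` in the estimate of the coordinate `i`. -/
noncomputable def coordWeight {d : ℕ} (n : ℕ) (i : Fin d) (k : ℕ) : ℝ :=
  if k % d = i then (n : ℝ)⁻¹ else 0

/-- The vector of coordinatewise averages of the first `n * d` terms of `y`, where the term `k`
belongs to the coordinate `k % d`. -/
noncomputable def coordMean {d : ℕ} (n : ℕ) (y : ℕ → ℝ) : EuclideanSpace ℝ (Fin d) :=
  WithLp.toLp 2 fun i => ∑ k ∈ Finset.range (n * d), coordWeight n i k * y k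

/-- The average of the terms `m, …, 2 * m - 1` of `y`. -/
noncomputable def secondMean (m : ℕ) (y : ℕ → ℝ) : ℝ :=
  ∑ k ∈ Finset.Ico m (2 * m), (m : ℝ)⁻¹ * y k

variable {d : ℕ}

@[fun_prop]
lemma measurable_coordMean (n : ℕ) : Measurable (coordMean (d := d) n) := by
  unfold coordMean
  apply (WithLp.measurable_toLp 2 (Fin d → ℝ)).comp
  fun_prop

lemma sum_coordWeight_mul (hd : 0 < d) {n : ℕ} (hn : 0 < n) (i : Fin d) (f : Fin d → ℝ) :
    ∑ k ∈ Finset.range (n * d), coordWeight n i k * f ⟨k % d, Nat.mod_lt _ hd⟩ = f i := by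
  have h := sum_range_mul_mod hd n fun j => (if j = i then (n : ℝ)⁻¹ else 0) * f j
  have hn' : (n : ℝ) ≠ 0 := by positivity
  simp only [Fin.ext_iff, ite_mul, zero_mul] at h
  simp only [coordWeight, ite_mul, zero_mul]
  rw [h]
  simp [← Fin.ext_iff, hn']

lemma sum_coordWeight_sq (hd : 0 < d) {n : ℕ} (hn : 0 < n) (i : Fin d) :
    ∑ k ∈ Finset.range (n * d), coordWeight n i k ^ 2 = (n : ℝ)⁻¹ := by
  have h := sum_coordWeight_mul hd hn i fun _ => (n : ℝ)⁻¹
  rw [← h]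
  refine Finset.sum_congr rfl fun k _ => ?_
  unfold coordWeight
  split_ifs <;> ring

lemma coordMean_add (hd : 0 < d) {n : ℕ} (hn : 0 < n) (θ : EuclideanSpace ℝ (Fin d))
    (η y : ℕ → ℝ) (hy : ∀ k < n * d, y k = θ ⟨k % d, Nat.mod_lt _ hd⟩ + η k) :
    coordMean n y = θ + coordMean n η := by
  ext i
  simp only [coordMean, PiLp.add_apply]
  rw [← sum_coordWeight_mul hd hn i (fun j => θ j), ← Finset.sum_add_distrib]
  refine Finset.sum_congr rfl fun k hk => ?_
  rw [hy k (Finset.mem_range.1 hk), mul_add]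

lemma inner_coordMean (hd : 0 < d) (n : ℕ) (η : ℕ → ℝ) (u : EuclideanSpace ℝ (Fin d)) :
    inner ℝ (coordMean n η) u =
      ∑ k ∈ Finset.range (n * d), (n : ℝ)⁻¹ * u ⟨k % d, Nat.mod_lt _ hd⟩ * η k := by
  simp only [PiLp.inner_apply, coordMean, RCLike.inner_apply, conj_trivial, Finset.mul_sum]
  rw [Finset.sum_comm]
  refine Finset.sum_congr rfl fun k _ => ?_
  rw [Finset.sum_eq_single ⟨k % d, Nat.mod_lt _ hd⟩]
  · simp [coordWeight]; ring
  · intro i _ hi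
    have : ¬ (k % d = i) := fun h => hi (Fin.ext h.symm)
    simp [coordWeight, this]
  · simp

/-- A fixed direction sees noise of variance `‖u‖²/n`, free of the dimension. -/
lemma noiseLaw_inner_coordMean_ge (hd : 0 < d) {n : ℕ} (hn : 0 < n)
    (u : EuclideanSpace ℝ (Fin d)) (hu : ‖u‖ ≤ 1) {t : ℝ} (ht : 0 ≤ t) :
    noiseLaw.real {η | t ≤ |inner ℝ (coordMean n η) u|} ≤ 2 * Real.exp (-(n * t ^ 2) / 2) := by
  have hn' : (0 : ℝ) < n := by exact_mod_cast hn
  have hv : ∑ k ∈ Finset.range (n * d), ((n : ℝ)⁻¹ * u ⟨k % d, Nat.mod_lt _ hd⟩) ^ 2 ≤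
      (n : ℝ)⁻¹ := by
    rw [sum_range_mul_mod hd n fun i => ((n : ℝ)⁻¹ * u i) ^ 2]
    simp only [mul_pow, ← Finset.mul_sum]
    have : ∑ i, u i ^ 2 ≤ 1 := by
      rw [← EuclideanSpace.real_norm_sq_eq]
      nlinarith [norm_nonneg u]
    calc (n : ℝ) * ((n : ℝ)⁻¹ ^ 2 * ∑ i, u i ^ 2) = (n : ℝ)⁻¹ * ∑ i, u i ^ 2 := by
          field_simp
      _ ≤ (n : ℝ)⁻¹ * 1 := by gcongr
      _ = _ := mul_one _
  have h := noiseLaw_abs_sum_mul_ge _ _ (by positivity) hv ht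
  simp only [inner_coordMean hd]
  convert h using 3
  field_simp

/-- Each coordinate becomes standard Gaussian after scaling by `√n`, so `noiseLaw_sum_sq_ge`
applies. -/
lemma noiseLaw_norm_coordMean_ge (hd : 0 < d) {n : ℕ} (hn : 0 < n) {t : ℝ} :
    noiseLaw.real {η | d * t ^ 2 ≤ ‖coordMean (d := d) n η‖ ^ 2} ≤
      2 * Real.exp (-(n * t ^ 2) / 4) := by
  have hn' : (0 : ℝ) < n := by exact_mod_cast hn
  have h := noiseLaw_sum_sq_ge hd (Finset.range (n * d)) (fun i k => √n * coordWeight n i k)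
    (fun i => by
      simp only [mul_pow, ← Finset.mul_sum, sum_coordWeight_sq hd hn]
      rw [Real.sq_sqrt hn'.le, mul_inv_cancel₀ hn'.ne']) (n * t ^ 2)
  refine le_trans (le_of_eq ?_) h
  congr 1
  ext η
  simp only [Set.mem_ofPred_eq, mul_assoc, ← Finset.mul_sum, mul_pow]
  rw [Real.sq_sqrt hn'.le, EuclideanSpace.real_norm_sq_eq]
  simp only [coordMean]
  rw [mul_left_comm, mul_le_mul_iff_right₀ hn']

lemma noiseLaw_secondMean_ge {m : ℕ} (hm : 0 < m) {t : ℝ} (ht : 0 ≤ t) :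
    noiseLaw.real {η | t ≤ |secondMean m η|} ≤ 2 * Real.exp (-(m * t ^ 2) / 2) := by
  have hm' : (0 : ℝ) < m := by exact_mod_cast hm
  have h := noiseLaw_abs_sum_mul_ge (Finset.Ico m (2 * m)) (fun _ => (m : ℝ)⁻¹)
    (v := (m : ℝ)⁻¹) (by positivity) (by
      simp only [Finset.sum_const, Nat.card_Ico, nsmul_eq_mul, two_mul, Nat.add_sub_cancel]
      apply le_of_eq
      field_simp) ht
  simp only [secondMean]
  convert h using 3
  field_simp

lemma secondMean_eq {m : ℕ} (hm : 0 < m) (a : ℝ) (η y : ℕ → ℝ)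
    (hy : ∀ k, m ≤ k → k < 2 * m → y k = a + η k) :
    secondMean m y = a + secondMean m η := by
  have hm' : (0 : ℝ) < m := by exact_mod_cast hm
  have : ∑ k ∈ Finset.Ico m (2 * m), (m : ℝ)⁻¹ * a = a := by
    simp only [Finset.sum_const, Nat.card_Ico, nsmul_eq_mul, two_mul, Nat.add_sub_cancel]
    field_simp
  unfold secondMean
  conv_rhs => rw [← this]
  rw [← Finset.sum_add_distrib]
  refine Finset.sum_congr rfl fun k hk => ?_
  rw [Finset.mem_Ico] at hk
  rw [hy k hk.1 hk.2, mul_add]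

end Averages

/-! ### The two-stage algorithm and its deterministic error analysis -/

section TwoStage

/-- The extension of a finite sequence by zeros. -/
def extendZero {t : ℕ} (y : Fin t → ℝ) (k : ℕ) : ℝ := if h : k < t then y ⟨k, h⟩ else 0

@[fun_prop]
lemma measurable_extendZero (t : ℕ) : Measurable (extendZero (t := t)) := by
  refine measurable_pi_lambda _ fun k => ?_
  unfold extendZero
  split_ifs <;> fun_prop

lemma BallAlgorithm.history_apply {d : ℕ} (A : BallAlgorithm d) (θ : EuclideanSpace ℝ (Fin d))
    (u : A.Seed) (η : ℕ → ℝ) (t k : ℕ) (hk : k < t) :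
    A.history θ u η t ⟨k, hk⟩ = inner ℝ (A.query k u (A.history θ u η k)) θ + η k := by
  induction t with
  | zero => omega
  | succ t ih =>
    rw [BallAlgorithm.history]
    rcases Nat.lt_succ_iff_lt_or_eq.1 hk with h | rfl
    · rw [← ih h]
      exact Fin.snoc_castSucc (α := fun _ => ℝ) _ _ (⟨k, h⟩ : Fin t)
    · exact Fin.snoc_last (α := fun _ => ℝ) _ _

/-- The algorithm that first queries every vector of the standard basis `n` times, then queries
`n * d` times the direction of the average `coordMean` of the observations, and returns the square
root of the estimate of `⟪coordMean, θ⟫` obtained in this way. -/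
noncomputable def twoStage {d : ℕ} (hd : 0 < d) (n : ℕ) : BallAlgorithm d where
  Seed := Unit
  seedLaw := Measure.dirac ()
  query t _ y :=
    if t < n * d then EuclideanSpace.single ⟨t % d, Nat.mod_lt _ hd⟩ 1
    else ‖coordMean (d := d) n (extendZero y)‖⁻¹ • coordMean n (extendZero y)
  halt t _ _ := t = 2 * (n * d)
  output _ _ y := √(‖coordMean (d := d) n (extendZero y)‖ * secondMean (n * d) (extendZero y))
  norm_query_le t u y := by
    split_ifs
    · simp
    · rw [norm_smul, norm_inv, norm_norm]
      exact inv_mul_le_one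
  measurable_query t := by
    split_ifs
    · fun_prop
    · fun_prop
  measurableSet_halt t := MeasurableSet.const _
  measurable_output t := by
    unfold secondMean
    fun_prop

variable {d : ℕ} (hd : 0 < d) (n : ℕ) (θ : EuclideanSpace ℝ (Fin d))

lemma numSamples_twoStage (u : (twoStage hd n).Seed) (η : ℕ → ℝ) :
    (twoStage hd n).numSamples θ u η = (2 * (n * d) : ℕ) := by
  simp only [BallAlgorithm.numSamples, twoStage, iInf_iInf_eq_left]

lemma estimate_twoStage (hn : 0 < n) (u : (twoStage hd n).Seed) (η : ℕ → ℝ) :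
    (twoStage hd n).estimate θ u η =
      √(inner ℝ (θ + coordMean n η) θ + ‖θ + coordMean n η‖ * secondMean (n * d) η) := by
  set H := (twoStage hd n).history θ u η with hH
  have hy : ∀ t k, k < t → extendZero (H t) k =
      inner ℝ ((twoStage hd n).query k u (H k)) θ + η k := by
    intro t k hk
    rw [extendZero, dif_pos hk, hH, BallAlgorithm.history_apply]
  -- `coordMean` reads only the first `n * d` rewards, so the direction stays frozen throughout the
  -- second stage.
  have hC : ∀ t, n * d ≤ t → coordMean n (extendZero (H t)) = θ + coordMean n η := by
    intro t ht
    refine coordMean_add hd hn θ η _ fun k hk => ?_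
    rw [hy t k (hk.trans_le ht)]
    simp [twoStage, hk, EuclideanSpace.inner_single_left]
  have hS : secondMean (n * d) (extendZero (H (2 * (n * d)))) =
      inner ℝ (‖θ + coordMean n η‖⁻¹ • (θ + coordMean n η)) θ + secondMean (n * d) η := by
    refine secondMean_eq (by positivity) _ _ _ fun k hk hk' => ?_
    rw [hy _ k hk', ← hC k hk]
    simp [twoStage, hk.not_gt]
  have hE : (twoStage hd n).estimate θ u η =
      √(‖coordMean (d := d) n (extendZero (H (2 * (n * d))))‖ *
        secondMean (n * d) (extendZero (H (2 * (n * d))))) := by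
    rw [BallAlgorithm.estimate, numSamples_twoStage]
    rfl
  rw [hE, hS, hC _ (by omega), mul_add, inner_smul_left]
  congr 2
  -- If the average vanishes, the inverse norm is `0` by convention and both sides are `0`.
  by_cases h0 : θ + coordMean n η = 0
  · simp [h0]
  · have : ‖θ + coordMean n η‖ ≠ 0 := norm_ne_zero_iff.2 h0
    simp only [conj_trivial]
    rw [mul_inv_cancel_left₀ this]

/-- If `√T > a + ε`, the squares differ by more than `ε(2a + ε)`. If `√T < a - ε`, they differ by
more than `εa`, and `a > ε` forces `εa ≥ ε(a + ε)/2`. -/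
lemma abs_sqrt_sub_le {T a ε : ℝ} (ha : 0 ≤ a) (hε : 0 < ε)
    (h : |T - a ^ 2| ≤ ε * (a + ε) / 2) : |√T - a| ≤ ε := by
  have hs : |√T ^ 2 - a ^ 2| ≤ ε * (a + ε) / 2 := by
    rcases le_total 0 T with hT | hT
    · rwa [Real.sq_sqrt hT]
    -- Truncating a nonpositive `T` to `0` only moves it closer to `a ^ 2`.
    · rw [Real.sqrt_eq_zero_of_nonpos hT]
      rw [abs_le] at h ⊢
      constructor <;> nlinarith [sq_nonneg a]
  have hs0 := Real.sqrt_nonneg T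
  rw [abs_le] at hs ⊢
  constructor
  · by_contra hc
    push Not at hc
    nlinarith
  · by_contra hc
    push Not at hc
    nlinarith

lemma abs_estimate_twoStage_sub_le (hn : 0 < n) (u : (twoStage hd n).Seed) (η : ℕ → ℝ) {ε : ℝ}
    (hε : 0 < ε) (h1 : |inner ℝ (coordMean n η) (‖θ‖⁻¹ • θ)| ≤ ε / 4)
    (h2 : ‖coordMean (d := d) n η‖ ^ 2 ≤ d * ε ^ 2)
    (h3 : |secondMean (n * d) η| ≤ ε / (4 * √d)) :
    |(twoStage hd n).estimate θ u η - ‖θ‖| ≤ ε := by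
  have hd' : (1 : ℝ) ≤ d := by exact_mod_cast hd
  have hsd : 1 ≤ √(d : ℝ) := Real.one_le_sqrt.2 hd'
  rw [estimate_twoStage hd n θ hn]
  refine abs_sqrt_sub_le (norm_nonneg _) hε ?_
  set W : EuclideanSpace ℝ (Fin d) := coordMean n η
  have hW : ‖W‖ ≤ √d * ε := by
    refine le_of_sq_le_sq ?_ (by positivity)
    rwa [mul_pow, Real.sq_sqrt (by positivity)]
  have hA : |inner ℝ W θ| ≤ ‖θ‖ * (ε / 4) := by
    have : inner ℝ W θ = ‖θ‖ * inner ℝ W (‖θ‖⁻¹ • θ) := by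
      by_cases h0 : θ = 0
      · simp [h0]
      · rw [inner_smul_right, mul_inv_cancel_left₀ (norm_ne_zero_iff.2 h0)]
    rw [this, abs_mul, abs_norm]
    gcongr
  have hB : |‖θ + W‖ * secondMean (n * d) η| ≤ (‖θ‖ + ε) * (ε / 4) := by
    rw [abs_mul, abs_norm]
    calc ‖θ + W‖ * |secondMean (n * d) η| ≤ (‖θ‖ + √d * ε) * (ε / (4 * √d)) := by
          gcongr
          exact (norm_add_le _ _).trans (by gcongr)
      _ ≤ (√d * ‖θ‖ + √d * ε) * (ε / (4 * √d)) := by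
          gcongr
          exact le_mul_of_one_le_left (norm_nonneg _) hsd
      _ = _ := by field_simp
  rw [inner_add_left, real_inner_self_eq_norm_sq]
  rw [abs_le] at hA hB ⊢
  constructor <;> nlinarith [mul_pos hε hε]

end TwoStage

/-! ### Constants and the union bound -/

lemma two_mul_exp_neg_le {δ x : ℝ} (hδ : 0 < δ)
    (hx : 3 * max 1 (Real.log (1 / δ)) ≤ x) : 2 * Real.exp (-x) ≤ δ / 3 := by
  have h1 : Real.exp (-x) ≤ Real.exp (-2 + Real.log δ) := by
    rw [one_div, Real.log_inv] at hx
    have := le_max_left 1 (-Real.log δ)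
    have := le_max_right 1 (-Real.log δ)
    gcongr
    linarith
  rw [Real.exp_add, Real.exp_log hδ] at h1
  have h2 : Real.exp (-2) ≤ 1 / 6 := by
    rw [Real.exp_neg, one_div]
    apply inv_anti₀ (by norm_num)
    have h := Real.exp_one_gt_d9
    rw [show (2 : ℝ) = 1 + 1 by norm_num, Real.exp_add]
    nlinarith
  nlinarith

theorem mainTheorem2 :
    ∃ C : ℝ, 0 < C ∧
      ∀ (d : ℕ) (ε δ : ℝ), 1 ≤ d → 0 < ε → ε ≤ 1 → 0 < δ → δ < 1 →
        ∃ A : BallAlgorithm d, ∀ θ : EuclideanSpace ℝ (Fin d),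
          (∀ (u : A.Seed) (η : ℕ → ℝ), ∃ n : ℕ, A.numSamples θ u η = n ∧
            (n : ℝ) ≤ C * (d * max 1 (Real.log (1 / δ)) / ε ^ 2)) ∧
          1 - δ ≤ A.law.real {p | |A.estimate θ p.1 p.2 - ‖θ‖| ≤ ε} := by
  refine ⟨202, by norm_num, fun d ε δ hd hε hε1 hδ _ => ?_⟩
  set L := max 1 (Real.log (1 / δ)) with hL
  have hL1 : 1 ≤ L := le_max_left _ _
  -- `B1` and `B3` are the tight events: both have exponent `n ε²/32 ≥ 100 L/32 ≥ 3 L`. Rounding up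
  -- costs at most `L/ε²`, whence `202 = 2 * 101`.
  set n := ⌈100 * L / ε ^ 2⌉₊
  have hd' : (0 : ℝ) < d := by exact_mod_cast hd
  have hε2 : ε ^ 2 ≤ 1 := by nlinarith
  have hpos : 0 < 100 * L / ε ^ 2 := by positivity
  have hn : 0 < n := Nat.ceil_pos.2 hpos
  have hnε : 100 * L ≤ n * ε ^ 2 := by
    have := Nat.le_ceil (100 * L / ε ^ 2)
    rwa [div_le_iff₀ (by positivity)] at this
  refine ⟨twoStage hd n, fun θ => ⟨fun u η => ⟨_, numSamples_twoStage hd n θ u η, ?_⟩, ?_⟩⟩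
  · have h1 : (n : ℝ) ≤ 101 * (L / ε ^ 2) := by
      have h := (Nat.ceil_lt_add_one hpos.le).le
      have : 1 ≤ L / ε ^ 2 := by
        rw [le_div_iff₀ (by positivity)]
        linarith
      have h' : 100 * L / ε ^ 2 = 100 * (L / ε ^ 2) := by ring
      linarith
    push_cast
    calc 2 * ((n : ℝ) * d) ≤ 2 * (101 * (L / ε ^ 2) * d) := by gcongr
      _ = _ := by ring
  · set B1 := {η | ε / 4 ≤ |inner ℝ (coordMean n η) (‖θ‖⁻¹ • θ)|}
    set B2 := {η | d * ε ^ 2 ≤ ‖coordMean (d := d) n η‖ ^ 2}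
    set B3 := {η | ε / (4 * √d) ≤ |secondMean (n * d) η|}
    have hB1 : noiseLaw.real B1 ≤ δ / 3 := by
      refine (noiseLaw_inner_coordMean_ge hd hn _ ?_ (by positivity)).trans ?_
      · rw [norm_smul, norm_inv, norm_norm]
        exact inv_mul_le_one
      · rw [neg_div]
        exact two_mul_exp_neg_le hδ (by rw [← hL]; nlinarith)
    have hB2 : noiseLaw.real B2 ≤ δ / 3 := by
      refine (noiseLaw_norm_coordMean_ge hd hn).trans ?_
      rw [neg_div]
      exact two_mul_exp_neg_le hδ (by rw [← hL]; linarith)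
    have hB3 : noiseLaw.real B3 ≤ δ / 3 := by
      refine (noiseLaw_secondMean_ge (by positivity) (by positivity)).trans ?_
      have : ((n * d : ℕ) : ℝ) * (ε / (4 * √d)) ^ 2 = n * ε ^ 2 / 16 := by
        rw [div_pow, mul_pow, Real.sq_sqrt hd'.le]
        push_cast
        field_simp
        norm_num
      rw [this, neg_div]
      exact two_mul_exp_neg_le hδ (by rw [← hL]; linarith)
    have hB : noiseLaw.real (B1 ∪ B2 ∪ B3) ≤ δ := by
      have h1 := measureReal_union_le (μ := noiseLaw) (B1 ∪ B2) B3
      have h2 := measureReal_union_le (μ := noiseLaw) B1 B2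
      linarith
    set G : Set ((twoStage hd n).Seed × (ℕ → ℝ)) :=
      {p | |(twoStage hd n).estimate θ p.1 p.2 - ‖θ‖| ≤ ε}
    have hsub : Gᶜ ⊆ Prod.snd ⁻¹' (B1 ∪ B2 ∪ B3) := by
      intro p hp
      by_contra hc
      simp only [B1, B2, B3, Set.mem_preimage, Set.mem_union, Set.mem_ofPred_eq, not_or,
        not_le] at hc
      exact hp (abs_estimate_twoStage_sub_le hd n θ hn p.1 p.2 hε hc.1.1.le hc.1.2.le hc.2.le)
    have : IsProbabilityMeasure (twoStage hd n).law := by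
      unfold BallAlgorithm.law
      infer_instance
    have hmap : (twoStage hd n).law.map Prod.snd = noiseLaw := by
      unfold BallAlgorithm.law
      exact measurePreserving_snd.map_eq
    have hbad : (twoStage hd n).law.real Gᶜ ≤ δ := by
      refine (measureReal_mono hsub).trans (le_trans ?_ hB)
      refine ENNReal.toReal_mono (by finiteness) ?_
      rw [← hmap]
      exact Measure.le_map_apply measurable_snd.aemeasurable _
    -- Subadditivity replaces the complement formula, so measurability of `G` is not needed.
    have htot := measureReal_union_le (μ := (twoStage hd n).law) G Gᶜ
    rw [Set.union_compl_self, probReal_univ] at htot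
    linarith
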